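/- Let $p$ be an odd prime and $g \ge 1$ an integer. In the polynomial ring $\mathbb{F}_p[z_1,\ldots,z_{2g-1}][x]$ let $c_k$ denote the coefficient of $x^k$ in $$\bigl(x(x-1)(x-z_1)(x-z_2)\cdots(x-z_{2g-1})\bigr)^{(p-1)/2},$$ so that $c_k \in \mathbb{F}_p[z_1,\ldots,z_{2g-1}]$ (with $c_k = 0$ for $k<0$). Let $I$ be the ideal of $\mathbb{F}_p[z_1,\ldots,z_{2g-1}]$ generated by the entries $c_{ip-j}$, $1\le i,j\le g$, of the Cartier--Manin matrix, and let $X = \operatorname{Spec}\bigl(\mathbb{F}_p[z_1,\ldots,z_{2g-1}]/I\bigr)$. Then the scheme $X$ is reduced. Moreover $X$ is zero-dimensional (that is, of Krull dimension at most $0$, as $X$ may be empty), and it is nonsingular, i.e. all its local rings are regular. -/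

import Mathlib

noncomputable section

/-- The polynomial `x (x - 1) (x - z_1) ⋯ (x - z_{2g-1})` in the indeterminate `x`, with
coefficients in `𝔽_p[z_1, …, z_{2g-1}]`. -/
def legendrePoly (p g : ℕ) : Polynomial (MvPolynomial (Fin (2 * g - 1)) (ZMod p)) :=
  Polynomial.X * (Polynomial.X - 1) *
    ∏ l : Fin (2 * g - 1), (Polynomial.X - Polynomial.C (MvPolynomial.X l))

/-- `c_k`: the `x^k`-coefficient of `(x (x - 1) (x - z_1) ⋯ (x - z_{2g-1}))^((p-1)/2)`. -/
def cartierManinCoeff (p g k : ℕ) : MvPolynomial (Fin (2 * g - 1)) (ZMod p) :=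
  (legendrePoly p g ^ ((p - 1) / 2)).coeff k

/-- The ideal of `𝔽_p[z_1, …, z_{2g-1}]` generated by the entries `c_{ip-j}`, `1 ≤ i, j ≤ g`, of
the Cartier–Manin matrix. The index `i p - j` is computed in `ℤ`; where it is negative the
coefficient is zero and contributes no generator. -/
def cartierManinIdeal (p g : ℕ) : Ideal (MvPolynomial (Fin (2 * g - 1)) (ZMod p)) :=
  Ideal.span {c | ∃ i ∈ Finset.Icc 1 g, ∃ j ∈ Finset.Icc 1 g, ∃ k : ℕ,
    (k : ℤ) = (i : ℤ) * p - j ∧ c = cartierManinCoeff p g k}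

/-- The closed subscheme of affine `(2g-1)`-space over `𝔽_p` cut out by the entries of the
Cartier–Manin matrix. -/
def cartierManinScheme (p g : ℕ) : AlgebraicGeometry.Scheme.{0} :=
  AlgebraicGeometry.Spec
    (CommRingCat.of (MvPolynomial (Fin (2 * g - 1)) (ZMod p) ⧸ cartierManinIdeal p g))

/-- A scheme is nonsingular if all its local rings are regular. -/
def IsNonsingularScheme (X : AlgebraicGeometry.Scheme.{0}) : Prop :=
  ∀ x : X, IsRegularLocalRing (X.presheaf.stalk x)

end

open Polynomial

/-! Put `p = 2n + 1`. It suffices that the quotient ring is unramified over `𝔽_p`: it is then finite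
and reduced, and its local rings are fields. So every derivation into a residue field `K` has to
vanish. A closed point gives `f` of degree `2g + 1` over `K`, with roots `0`, `1`, ..., such that `q
f^n` is a derivative whenever `deg q < g`: on `y² = f` the Cartier operator kills each `q dx / y =
y^(-p) q f^n dx`. A derivation gives a variation `u` of `f` with all `x^j u f^(n-1)`, `j < g`,
exact. The key is `IsSuperspecialPoly.degree_lt_of_mem_exactPolys`, a dimension count: for distinct
roots, no `q` with `g ≤ deg q < 2g` makes `q f^n` exact. Write `u = v f' + w f`, so that `-v` gives
the velocities of the roots. Subtracting a multiple of `x^j u f^(n-1)` from `(x^j v f^n)'` leaves an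
exact `b f^n`, whose leading term excludes `g < j + deg v ≤ 2g`. Taking `j = 0` and `j = g - 1`
yields `deg v ≤ 1`; as `0` and `1` stay fixed, `v = 0` and then `u = 0`. The same bound, by
induction on `g`, rules out multiple roots. -/

/-- The polynomials that are derivatives of polynomials. -/
noncomputable def exactPolys (K : Type*) [Field K] : Submodule K K[X] := LinearMap.range (derivative (R := K))

/-- The polynomial `f` (of degree `2g+1`) has vanishing Cartier–Manin matrix: in characteristic
`2n+1`, all differentials `q f^n dx` with `deg q < g` are exact. -/
def IsSuperspecialPoly {K : Type*} [Field K] (n g : ℕ) (f : K[X]) : Prop :=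
  ∀ q : K[X], q.degree < g → q * f ^ n ∈ exactPolys K

/-- The formal antiderivative of the terms of degree less than `N`. -/
noncomputable def antiderivative (K : Type*) [Field K] (N : ℕ) : K[X] →ₗ[K] K[X] :=
  ∑ m ∈ Finset.range N, (monomial (m + 1)).comp (((m + 1 : ℕ) : K)⁻¹ • lcoeff K m)

/-! ### Exact polynomials in characteristic `p` -/

section Exact

variable {K : Type*} [Field K]

lemma derivative_mem_exactPolys (H : K[X]) : derivative H ∈ exactPolys K := ⟨H, rfl⟩

lemma antiderivative_apply (N : ℕ) (G : K[X]) : antiderivative K N G =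
    ∑ m ∈ Finset.range N, monomial (m + 1) (((m + 1 : ℕ) : K)⁻¹ * G.coeff m) := by
  simp [antiderivative, LinearMap.sum_apply]

lemma degree_antiderivative_lt (N : ℕ) (G : K[X]) :
    (antiderivative K N G).degree < (N + 1 : ℕ) := by
  rw [antiderivative_apply]
  refine (degree_sum_le _ _).trans_lt ?_
  rw [Finset.sup_lt_iff (WithBot.bot_lt_coe _)]
  intro m hm
  refine (degree_monomial_le _ _).trans_lt ?_
  have := Finset.mem_range.1 hm
  exact_mod_cast Nat.succ_lt_succ this

lemma exactPolys_mul_of_derivative_eq_zero {G E : K[X]} (hG : G ∈ exactPolys K)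
    (hE : derivative E = 0) : E * G ∈ exactPolys K := by
  obtain ⟨H, rfl⟩ := hG
  exact ⟨E * H, by simp [derivative_mul, hE]⟩

lemma taylor_mem_exactPolys {G : K[X]} (a : K) (hG : G ∈ exactPolys K) :
    taylor a G ∈ exactPolys K := by
  obtain ⟨H, rfl⟩ := hG
  exact ⟨taylor a H, by simp [taylor_apply, derivative_comp]⟩

lemma taylor_mem_exactPolys_iff {G : K[X]} (a : K) :
    taylor a G ∈ exactPolys K ↔ G ∈ exactPolys K := by
  refine ⟨fun h => ?_, taylor_mem_exactPolys a⟩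
  simpa [taylor_taylor] using taylor_mem_exactPolys (-a) h

variable {p : ℕ} [hp : Fact p.Prime] [CharP K p]

omit hp in
lemma coeff_eq_zero_of_mem_exactPolys {G : K[X]} (hG : G ∈ exactPolys K) {m : ℕ}
    (hm : p ∣ m + 1) : G.coeff m = 0 := by
  obtain ⟨H, rfl⟩ := hG
  have : ((m : K) + 1) = 0 := by exact_mod_cast (CharP.cast_eq_zero_iff K p (m + 1)).2 hm
  rw [coeff_derivative, this, mul_zero]

omit hp in
lemma derivative_antiderivative {N : ℕ} {G : K[X]} (hN : G.natDegree < N)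
    (hG : ∀ m, p ∣ m + 1 → G.coeff m = 0) : derivative (antiderivative K N G) = G := by
  rw [antiderivative_apply, derivative_sum]
  conv_rhs => rw [G.as_sum_range' N hN]
  refine Finset.sum_congr rfl fun m _ => ?_
  rw [derivative_monomial, Nat.add_sub_cancel]
  congr 1
  by_cases h : p ∣ m + 1
  · rw [hG m h]; simp
  · have : ((m + 1 : ℕ) : K) ≠ 0 := fun h' => h ((CharP.cast_eq_zero_iff K p (m + 1)).1 h')
    field_simp

omit hp in
lemma mem_exactPolys_iff {G : K[X]} : G ∈ exactPolys K ↔ ∀ m, p ∣ m + 1 → G.coeff m = 0 := by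
  refine ⟨fun h m hm => coeff_eq_zero_of_mem_exactPolys h hm, fun h => ?_⟩
  exact ⟨_, derivative_antiderivative (Nat.lt_succ_self G.natDegree) h⟩

lemma X_sub_C_pow_char (a : K) : (X - C a) ^ p = X ^ p - C (a ^ p) := by
  rw [sub_pow_char (R := K[X]) (p := p), C_pow]

lemma derivative_X_sub_C_pow_char (a : K) : derivative ((X - C a) ^ p) = 0 := by
  rw [X_sub_C_pow_char, derivative_sub, derivative_C, derivative_X_pow]
  simp

/-- After translating `a` to `0`, multiplication by `X ^ p` shifts exponents by `p`, preserving the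
residue class `-1` modulo `p` that obstructs integration. -/
lemma X_sub_C_pow_char_mul_mem_exactPolys_iff {G : K[X]} (a : K) :
    (X - C a) ^ p * G ∈ exactPolys K ↔ G ∈ exactPolys K := by
  refine ⟨fun h => ?_, fun h =>
    exactPolys_mul_of_derivative_eq_zero h (derivative_X_sub_C_pow_char a)⟩
  rw [← taylor_mem_exactPolys_iff a, taylor_mul, taylor_pow] at h
  rw [← taylor_mem_exactPolys_iff a]
  have e : taylor a (X - C a) = X := by simp
  rw [e, mem_exactPolys_iff (p := p)] at h
  rw [mem_exactPolys_iff (p := p)]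
  intro m hm
  have := h (m + p) (by rw [show m + p + 1 = m + 1 + p by ring]; exact (Nat.dvd_add_self_right).2 hm)
  rwa [coeff_X_pow_mul] at this

/-- After translating `a` to `0`, the obstructing coefficient at `X ^ (p - 1)` is the value of `G`
at `a`. -/
lemma eval_eq_zero_of_X_sub_C_pow_mul_mem_exactPolys {G : K[X]} (a : K)
    (h : (X - C a) ^ (p - 1) * G ∈ exactPolys K) : G.eval a = 0 := by
  rw [← taylor_mem_exactPolys_iff a, taylor_mul, taylor_pow] at h
  have e : taylor a (X - C a) = X := by simp
  have h1 : 1 ≤ p := hp.out.one_le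
  rw [e] at h
  have := coeff_eq_zero_of_mem_exactPolys (p := p) h (m := p - 1) (by rw [Nat.sub_add_cancel h1])
  rw [coeff_X_pow_mul', if_pos le_rfl, Nat.sub_self, taylor_coeff_zero] at this
  exact this

omit hp in
/-- In characteristic `p > n`, a polynomial vanishing at `a` whose derivative vanishes to order `n`
vanishes to order `n + 1`. -/
lemma X_sub_C_pow_succ_dvd {D : K[X]} {a : K} {n : ℕ} (hn : n < p) (h0 : D.eval a = 0)
    (h : (X - C a) ^ n ∣ derivative D) : (X - C a) ^ (n + 1) ∣ D := by
  have e : taylor a (X - C a) = X := by simp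
  have key : X ^ (n + 1) ∣ taylor a D := by
    rw [X_pow_dvd_iff]
    intro d hd
    rcases d with _ | d
    · rwa [taylor_coeff_zero]
    · have h2 : X ^ n ∣ derivative (taylor a D) := by
        obtain ⟨Q, hQ⟩ := h
        refine ⟨taylor a Q, ?_⟩
        have : derivative (taylor a D) = taylor a (derivative D) := by
          simp [taylor_apply, derivative_comp]
        rw [this, hQ, taylor_mul, taylor_pow, e]
      have h3 := X_pow_dvd_iff.1 h2 d (by omega)
      rw [coeff_derivative] at h3
      refine (mul_eq_zero.1 h3).resolve_right fun h4 => ?_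
      have h5 : ((d + 1 : ℕ) : K) = 0 := by exact_mod_cast h4
      rw [CharP.cast_eq_zero_iff K p] at h5
      exact absurd (Nat.le_of_dvd (Nat.succ_pos _) h5) (by omega)
  obtain ⟨Q, hQ⟩ := key
  refine ⟨taylor (-a) Q, ?_⟩
  have := congrArg (taylor (-a)) hQ
  simpa [taylor_taylor, taylor_mul, taylor_pow, sub_eq_add_neg] using this

/-- A superspecial polynomial of degree `2g+1` in characteristic `2n+1` has `g ≤ n`. -/
lemma IsSuperspecialPoly.le {n g : ℕ} {f : K[X]} (hpn : p = 2 * n + 1) (hf : f.Monic)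
    (hdeg : f.natDegree = 2 * g + 1) (h : IsSuperspecialPoly n g f) : g ≤ n := by
  -- If `n < g`, the power of `X` is chosen to give a monic product of degree `g p - 1`, whose
  -- leading coefficient obstructs exactness.
  by_contra! hlt
  have h1 := h (X ^ (g - n - 1)) (by rw [degree_X_pow]; exact_mod_cast (by omega))
  have h2 : (X ^ (g - n - 1) * f ^ n).natDegree = g * p - 1 := by
    rw [(monic_X_pow _).natDegree_mul (hf.pow n), natDegree_X_pow, hf.natDegree_pow, hdeg, hpn]
    have : n * (2 * g + 1) = g * (2 * n + 1) - g + n := by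
      have : g * (2 * n + 1) = 2 * n * g + g := by ring
      rw [this, Nat.add_sub_cancel]; ring
    rw [this]
    have : g ≤ g * (2 * n + 1) := Nat.le_mul_of_pos_right _ (by omega)
    omega
  have h3 : (X ^ (g - n - 1) * f ^ n).Monic := (monic_X_pow _).mul (hf.pow n)
  have h4 := coeff_eq_zero_of_mem_exactPolys (p := p) h1 (m := g * p - 1) (by
    rw [Nat.sub_add_cancel (Nat.mul_pos (by omega) hp.out.pos)]; exact dvd_mul_left _ _)
  rw [← h2, h3.coeff_natDegree] at h4
  exact one_ne_zero h4

end Exact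

/-! ### The dimension count and its consequence for deformations -/

section Kernel

variable {K : Type*} [Field K] {p : ℕ} [hp : Fact p.Prime] [CharP K p]

/-- If `f` is superspecial with distinct roots `s`, the polynomials `q` of degree less than `2g`
with `q f^n` exact all have degree less than `g`. -/
theorem IsSuperspecialPoly.degree_lt_of_mem_exactPolys {n g : ℕ} {s : Finset K}
    (hpn : p = 2 * n + 1) (hs : s.card = 2 * g + 1)
    (h : IsSuperspecialPoly n g (Lagrange.nodal s id)) {q : K[X]} (hq : q.degree < (2 * g : ℕ))
    (hqF : q * Lagrange.nodal s id ^ n ∈ exactPolys K) : q.degree < (g : ℕ) := by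
  classical
  have hn : 1 ≤ n := by have := hp.out.two_le; omega
  set f := Lagrange.nodal s (id : K → K) with hf
  have hfm : f.Monic := Lagrange.nodal_monic
  have hfd : f.natDegree = 2 * g + 1 := by rw [hf, Lagrange.natDegree_nodal, hs]
  -- Chosen so that `f ^ (n + 1)` has degree `N + 1`, just above every antiderivative `G r`.
  let N := g * p + n + g
  let V : Submodule K K[X] :=
    degreeLT K (2 * g) ⊓ (exactPolys K).comap (LinearMap.mulRight K (f ^ n))
  let G : K[X] →ₗ[K] K[X] := antiderivative K N ∘ₗ LinearMap.mulRight K (f ^ n)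
  -- Interpolating at the nodes `a ^ p` makes `(S r)(x ^ p)`, which has derivative zero, agree with
  -- `G r` on `s`.
  let S : K[X] →ₗ[K] K[X] := Lagrange.interpolate s (fun a : K => a ^ p) ∘ₗ
    (LinearMap.pi fun a => leval a) ∘ₗ G
  -- The coefficients of `S r` in degrees `g + 1` to `2g`; if they vanish, `(S r)(x ^ p)` has degree
  -- at most `g p ≤ N`.
  let T : V →ₗ[K] (Fin g → K) :=
    (LinearMap.pi fun i : Fin g => lcoeff K (g + 1 + i)) ∘ₗ S ∘ₗ V.subtype
  have hinj : Set.InjOn (fun a : K => a ^ p) s := fun a _ b _ hab => frobenius_inj K p hab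
  have hT : Function.Injective T := by
    rw [← LinearMap.ker_eq_bot, LinearMap.ker_eq_bot']
    rintro ⟨r, hr⟩ hTr
    obtain ⟨hr1, hr2⟩ := Submodule.mem_inf.1 hr
    rw [mem_degreeLT] at hr1
    have hr2 : r * f ^ n ∈ exactPolys K := hr2
    have hG : derivative (G r) = r * f ^ n := by
      refine derivative_antiderivative (p := p) ?_ fun m hm =>
        coeff_eq_zero_of_mem_exactPolys (p := p) hr2 hm
      change (r * f ^ n).natDegree < g * p + n + g
      by_cases hr0 : r = 0
      · simp only [hr0, zero_mul, natDegree_zero]; omega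
      · have h1 := (natDegree_lt_iff_degree_lt hr0).2 hr1
        refine natDegree_mul_le.trans_lt ?_
        rw [hfm.natDegree_pow, hfd, hpn]
        nlinarith
    have hSdeg : (S r).degree < (2 * g + 1 : ℕ) := by
      rw [← hs]; exact Lagrange.degree_interpolate_lt _ hinj
    have hSdeg2 : (S r).natDegree ≤ g := by
      rw [natDegree_le_iff_coeff_eq_zero]
      intro m hm
      by_cases hm2 : m < 2 * g + 1
      · have := congrFun hTr ⟨m - (g + 1), by omega⟩
        have h3 : (S r).coeff (g + 1 + (m - (g + 1))) = 0 := this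
        rwa [show g + 1 + (m - (g + 1)) = m by omega] at h3
      · exact coeff_eq_zero_of_degree_lt (hSdeg.trans_le (by exact_mod_cast (not_lt.1 hm2)))
    have hexp : derivative (expand K p (S r)) = 0 := by simp [derivative_expand]
    -- The difference vanishes at each root, and its derivative `r f ^ n` vanishes there to order
    -- `n`.
    have hdvd : f ^ (n + 1) ∣ G r - expand K p (S r) := by
      rw [hf, Lagrange.nodal, ← Finset.prod_pow]
      refine Finset.prod_dvd_of_coprime (fun a _ b _ hab => ?_) fun a ha => ?_
      · exact (pairwise_coprime_X_sub_C Function.injective_id hab).pow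
      · refine X_sub_C_pow_succ_dvd (p := p) (by omega) ?_ ?_
        · rw [eval_sub, expand_eval, sub_eq_zero]
          exact (Lagrange.eval_interpolate_at_node (fun b => (G r).eval b) hinj ha).symm
        · rw [derivative_sub, hexp, sub_zero, hG]
          exact dvd_mul_of_dvd_right
            (pow_dvd_pow_of_dvd (Finset.dvd_prod_of_mem (fun b => X - C (id b)) ha) n) r
    have hzero : G r - expand K p (S r) = 0 := by
      refine eq_zero_of_dvd_of_degree_lt hdvd ?_
      have e1 : (f ^ (n + 1)).degree = (N + 1 : ℕ) := by
        rw [degree_eq_natDegree (hfm.pow _).ne_zero, hfm.natDegree_pow, hfd]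
        congr 1
        simp only [N, hpn]; ring
      rw [e1]
      refine (degree_sub_le _ _).trans_lt (max_lt (degree_antiderivative_lt _ _) ?_)
      refine degree_le_natDegree.trans_lt ?_
      rw [natDegree_expand]
      have := Nat.mul_le_mul_right p hSdeg2
      exact_mod_cast (show (S r).natDegree * p < N + 1 by simp only [N]; omega)
    have := congrArg derivative hzero
    rw [derivative_sub, hexp, sub_zero, hG, derivative_zero] at this
    exact Subtype.ext ((mul_eq_zero.1 this).resolve_right (hfm.pow n).ne_zero)
  -- Superspeciality already supplies a `g`-dimensional subspace of `V`, and `T` bounds the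
  -- dimension of `V` by `g`.
  have hle : degreeLT K g ≤ V := by
    intro r hr
    refine Submodule.mem_inf.2 ⟨degreeLT_mono (by omega) hr, ?_⟩
    exact h r (mem_degreeLT.1 hr)
  have : FiniteDimensional K V := FiniteDimensional.of_injective T hT
  have hfin : Module.finrank K V ≤ Module.finrank K (degreeLT K g) := by
    have h1 := LinearMap.finrank_le_finrank_of_injective hT
    rw [Module.finrank_fin_fun] at h1
    rwa [(degreeLTEquiv K g).finrank_eq, Module.finrank_fin_fun]
  have heq := Submodule.eq_of_le_of_finrank_le hle hfin
  rw [← mem_degreeLT, heq]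
  exact Submodule.mem_inf.2 ⟨mem_degreeLT.2 hq, hqF⟩

/-- Let `f` be superspecial with distinct roots and `u = v f' + w f` of degree at most `2g`.
If `x^j u f^(n-1)` is exact, then `j + deg v` does not lie between `g + 1` and `2g`. -/
theorem IsSuperspecialPoly.add_natDegree_le {n g : ℕ} {s : Finset K}
    (hpn : p = 2 * n + 1) (hs : s.card = 2 * g + 1)
    (h : IsSuperspecialPoly n g (Lagrange.nodal s id)) {u v w : K[X]} {j : ℕ}
    (hu : u.natDegree ≤ 2 * g)
    (huv : u = v * derivative (Lagrange.nodal s id) + w * Lagrange.nodal s id)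
    (hex : X ^ j * u * Lagrange.nodal s id ^ (n - 1) ∈ exactPolys K)
    (hv : 1 ≤ v.natDegree) (hj : j + v.natDegree ≤ 2 * g) : j + v.natDegree ≤ g := by
  have hn : 1 ≤ n := by have := hp.out.two_le; omega
  have hgn : g ≤ n := h.le hpn Lagrange.nodal_monic (by rw [Lagrange.natDegree_nodal, hs])
  set f := Lagrange.nodal s (id : K → K) with hf
  have hfm : f.Monic := Lagrange.nodal_monic
  have hfd : f.natDegree = 2 * g + 1 := by rw [hf, Lagrange.natDegree_nodal, hs]
  obtain ⟨k, rfl⟩ := Nat.exists_eq_add_of_le' hn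
  obtain ⟨m, hm⟩ := Nat.exists_eq_add_of_le' hv
  rw [Nat.add_sub_cancel] at hex
  have hf'd : (derivative f).natDegree ≤ 2 * g := by
    have := natDegree_derivative_le f; omega
  have hvf : (v * derivative f).natDegree ≤ m + 1 + 2 * g :=
    natDegree_mul_le.trans (by omega)
  have hwd : w.natDegree ≤ m := by
    by_cases hw : w = 0
    · simp [hw]
    have h1 : (w * f).natDegree ≤ m + 1 + 2 * g := by
      have : w * f = u - v * derivative f := by rw [huv]; ring
      rw [this]
      exact (natDegree_sub_le _ _).trans (max_le (by omega) hvf)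
    rw [natDegree_mul hw hfm.ne_zero, hfd] at h1
    omega
  -- Since `deg u ≤ 2g`, the terms of `v f'` and `w f` in degree `deg v + 2g` cancel.
  have hwm : w.coeff m = -((2 * g + 1 : ℕ) : K) * v.coeff (m + 1) := by
    have h1 : u.coeff (m + 1 + 2 * g) = 0 := coeff_eq_zero_of_natDegree_lt (by omega)
    have h2 : (v * derivative f).coeff (m + 1 + 2 * g) =
        v.coeff (m + 1) * (derivative f).coeff (2 * g) :=
      coeff_mul_add_eq_of_natDegree_le (by omega) hf'd
    have h3 : (w * f).coeff (m + (2 * g + 1)) = w.coeff m * f.coeff (2 * g + 1) :=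
      coeff_mul_add_eq_of_natDegree_le hwd hfd.le
    have h4 : f.coeff (2 * g + 1) = 1 := by rw [← hfd]; exact hfm.coeff_natDegree
    rw [huv, coeff_add, h2, show m + 1 + 2 * g = m + (2 * g + 1) by ring, h3, coeff_derivative,
      h4] at h1
    push_cast at h1 ⊢
    linear_combination h1
  let b : K[X] := derivative (X ^ j * v) - C ((k + 1 : ℕ) : K) * (X ^ j * w)
  have hb : b * f ^ (k + 1) ∈ exactPolys K := by
    have e : b * f ^ (k + 1) =
        derivative (X ^ j * v * f ^ (k + 1)) - ((k + 1 : ℕ) : K) • (X ^ j * u * f ^ k) := by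
      rw [derivative_mul (f := X ^ j * v), derivative_pow_succ, huv, smul_eq_C_mul]
      simp only [b, map_add, map_natCast, Nat.cast_add, Nat.cast_one, C_1]
      ring
    rw [e]
    exact Submodule.sub_mem _ (derivative_mem_exactPolys _) (Submodule.smul_mem _ _ hex)
  have hbd : b.natDegree ≤ j + m := by
    refine (natDegree_sub_le _ _).trans (max_le ?_ ?_)
    · refine (natDegree_derivative_le _).trans ?_
      have := natDegree_mul_le (p := X ^ j) (q := v)
      rw [natDegree_X_pow] at this
      omega
    · refine (natDegree_C_mul_le _ _).trans (natDegree_mul_le.trans ?_)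
      rw [natDegree_X_pow]; omega
  have hbg : b.degree < (g : ℕ) := h.degree_lt_of_mem_exactPolys hpn hs
    (degree_le_natDegree.trans_lt (by exact_mod_cast (by omega))) hb
  by_contra! hlt
  have hc : b.coeff (j + m) = 0 :=
    coeff_eq_zero_of_degree_lt (hbg.trans_le (by exact_mod_cast (by omega)))
  have e1 : (X ^ j * v).coeff (j + m + 1) = v.coeff (m + 1) := by
    rw [coeff_X_pow_mul', if_pos (by omega)]; congr 1; omega
  have e2 : (X ^ j * w).coeff (j + m) = w.coeff m := by
    rw [coeff_X_pow_mul', if_pos (by omega)]; congr 1; omega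
  simp only [b, coeff_sub, coeff_derivative, coeff_C_mul, e1, e2, hwm] at hc
  have hvm : v.coeff (m + 1) ≠ 0 := by
    rw [← hm, coeff_natDegree, Ne, leadingCoeff_eq_zero]
    rintro rfl
    simp at hm
  have hp0 : (2 * ((k : K) + 1) + 1) = 0 := by
    have := CharP.cast_eq_zero K p
    rw [hpn] at this
    exact_mod_cast this
  -- As `2n = -1` in `K`, twice the coefficient of `b` in degree `j + m` is this number times the
  -- leading coefficient of `v`. It is odd and lies strictly between `0` and `2g < p`, so it cannot
  -- vanish in `K`.
  have h5 : ((2 * (j + m + 1) - (2 * g + 1) : ℕ) : K) = 0 := by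
    rw [Nat.cast_sub (by omega)]
    push_cast at hc ⊢
    refine (mul_eq_zero.1 ?_).resolve_right hvm
    linear_combination 2 * hc - (2 * (g : K) + 1) * v.coeff (m + 1) * hp0
  rw [CharP.cast_eq_zero_iff K p] at h5
  have := Nat.le_of_dvd (by omega) h5
  omega

end Kernel

/-! ### Distinctness of roots and rigidity -/

section Superspecial

variable {K : Type*} [Field K] {p : ℕ} [hp : Fact p.Prime] [CharP K p]

/-- A superspecial polynomial `∏ (x - a)`, `a ∈ S`, of degree `2g+1` with at least two distinct
roots has no multiple root. -/
theorem IsSuperspecialPoly.nodup {n g : ℕ} (hpn : p = 2 * n + 1) {S : Multiset K}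
    (hS : S.card = 2 * g + 1) (h : IsSuperspecialPoly n g (S.map fun a => X - C a).prod)
    (hne : ∀ a, S ≠ Multiset.replicate (2 * g + 1) a) : S.Nodup := by
  have hn : 1 ≤ n := by have := hp.out.two_le; omega
  induction g generalizing S with
  | zero =>
    obtain ⟨a, rfl⟩ := Multiset.card_eq_one.1 hS
    simp
  | succ g ih =>
    rw [Multiset.nodup_iff_le]
    intro a ha
    obtain ⟨S', rfl⟩ := Multiset.le_iff_exists_add.1 ha
    simp only [Multiset.cons_add, zero_add, Multiset.card_cons, Multiset.map_cons,
      Multiset.prod_cons] at hS h hne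
    have hS' : S'.card = 2 * g + 1 := by omega
    set f := (S'.map fun a => X - C a).prod with hf
    -- Removing a double root lowers the genus: `(x - a) ((x - a)² f)^n = (x - a)^p f^n`, and the
    -- `p`-th power does not affect exactness.
    have h1 : IsSuperspecialPoly n g f := by
      intro q hq
      rw [← X_sub_C_pow_char_mul_mem_exactPolys_iff (p := p) a]
      have := h (q * (X - C a)) (by
        rw [degree_mul, degree_X_sub_C]
        push_cast
        exact WithBot.add_lt_add_right (by simp) hq)
      convert this using 1
      rw [hpn]
      generalize X - C a = y
      ring
    have h2 : (X - C a) ^ (p - 1) * f ^ n ∈ exactPolys K := by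
      have := h 1 (by rw [degree_one]; exact_mod_cast Nat.succ_pos g)
      convert this using 1
      rw [hpn, Nat.add_sub_cancel]
      generalize X - C a = y
      ring
    -- A double root is thus at least triple.
    have h3 : a ∈ S' := by
      have h4 := eval_eq_zero_of_X_sub_C_pow_mul_mem_exactPolys (p := p) a h2
      rw [eval_pow] at h4
      have h5 : IsRoot f a := pow_eq_zero_iff (by omega) |>.1 h4
      rwa [← mem_roots (monic_multisetProd_X_sub_C S').ne_zero,
        roots_multiset_prod_X_sub_C] at h5
    have h4 : ∀ b, S' ≠ Multiset.replicate (2 * g + 1) b := by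
      rintro b rfl
      obtain rfl := Multiset.eq_of_mem_replicate h3
      exact hne a (by rw [← Multiset.replicate_succ, ← Multiset.replicate_succ]; rfl)
    have hnd : S'.Nodup := ih hS' h1 h4
    let s : Finset K := ⟨S', hnd⟩
    obtain ⟨S'', rfl⟩ := Multiset.exists_cons_of_mem h3
    set u := (S''.map fun a => X - C a).prod with hu
    have hum : u.Monic := monic_multisetProd_X_sub_C S''
    have hfu : f = (X - C a) * u := by rw [hf, Multiset.map_cons, Multiset.prod_cons]
    have hud : u.natDegree = 2 * g := by
      rw [hu, natDegree_multiset_prod_X_sub_C_eq_card]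
      simpa using hS'
    have hua : u.eval a ≠ 0 := by
      intro h5
      have h5 : IsRoot u a := h5
      rw [← mem_roots hum.ne_zero, hu, roots_multiset_prod_X_sub_C] at h5
      exact (Multiset.nodup_cons.1 hnd).1 h5
    have hex : X ^ 0 * u * f ^ (n - 1) ∈ exactPolys K := by
      rw [← X_sub_C_pow_char_mul_mem_exactPolys_iff (p := p) a]
      convert h2 using 1
      obtain ⟨k, rfl⟩ := Nat.exists_eq_add_of_le' hn
      rw [hpn, Nat.add_sub_cancel, Nat.add_sub_cancel, pow_succ f, pow_succ (X - C a)]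
      nth_rewrite 3 [hfu]
      ring
    -- With `f = (x - a) u`, the polynomial `v = u / u(a)` agrees with `u / f'` at all roots. Its
    -- degree `2g` contradicts the bound `g` obtained for `j = 0`.
    obtain ⟨t, ht⟩ : X - C a ∣ 1 - C (u.eval a)⁻¹ * derivative f := by
      rw [dvd_iff_isRoot, IsRoot, hfu, derivative_mul]
      simp [hua]
    have huv : u = C (u.eval a)⁻¹ * u * derivative f + t * f := by
      rw [hfu] at ht ⊢
      linear_combination u * ht
    have hvd : (C (u.eval a)⁻¹ * u).natDegree = 2 * g := by
      rw [natDegree_C_mul (inv_ne_zero hua), hud]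
    have hg : 1 ≤ g := by
      by_contra! hg
      obtain rfl : g = 0 := by omega
      obtain ⟨b, hb⟩ := Multiset.card_eq_one.1 hS'
      exact h4 b hb
    have := IsSuperspecialPoly.add_natDegree_le (s := s) (j := 0) hpn hS' h1 hud.le huv hex
      (by omega) (by omega)
    omega

/-- A first order deformation `u` of a superspecial polynomial that moves neither of two roots and
preserves superspeciality is trivial. -/
theorem IsSuperspecialPoly.eq_zero {n g : ℕ} (hpn : p = 2 * n + 1) {s : Finset K}
    (hs : s.card = 2 * g + 1) (h : IsSuperspecialPoly n g (Lagrange.nodal s id)) {u : K[X]}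
    (hu : u.natDegree ≤ 2 * g)
    (hex : ∀ j < g, X ^ j * u * Lagrange.nodal s id ^ (n - 1) ∈ exactPolys K)
    {a b : K} (ha : a ∈ s) (hb : b ∈ s) (hab : a ≠ b) (hua : u.eval a = 0) (hub : u.eval b = 0) :
    u = 0 := by
  classical
  have hg : 1 ≤ g := by
    have := Finset.one_lt_card.2 ⟨a, ha, b, hb, hab⟩
    omega
  set f := Lagrange.nodal s (id : K → K) with hf
  have hfd : f.natDegree = 2 * g + 1 := by rw [hf, Lagrange.natDegree_nodal, hs]
  let v := Lagrange.interpolate s id fun c => u.eval c / (derivative f).eval c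
  have hve : ∀ c ∈ s, v.eval c = u.eval c / (derivative f).eval c := fun c hc =>
    Lagrange.eval_interpolate_at_node _ Function.injective_id.injOn hc
  have hf' : ∀ c ∈ s, (derivative f).eval c ≠ 0 := by
    intro c hc
    have := Lagrange.eval_nodal_derivative_eval_node_eq (v := (id : K → K)) hc
    rw [id] at this
    rw [hf, this, Lagrange.eval_nodal, Finset.prod_ne_zero_iff]
    intro d hd
    exact sub_ne_zero.2 (Finset.ne_of_mem_erase hd).symm
  have hvd : v.natDegree ≤ 2 * g := by
    have := Lagrange.degree_interpolate_le (s := s) (v := id)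
      (fun c => u.eval c / (derivative f).eval c) Function.injective_id.injOn
    rw [hs, Nat.add_sub_cancel] at this
    exact natDegree_le_iff_degree_le.2 this
  obtain ⟨w, hw⟩ : f ∣ u - v * derivative f := by
    rw [hf, Lagrange.nodal]
    refine Finset.prod_dvd_of_coprime
      (fun _ _ _ _ hcd => pairwise_coprime_X_sub_C Function.injective_id hcd) fun c hc => ?_
    rw [dvd_iff_isRoot, IsRoot, id, eval_sub, eval_mul, hve c hc]
    exact sub_eq_zero.2 (div_mul_cancel₀ _ (hf' c hc)).symm
  have huv : u = v * derivative f + w * f := by linear_combination hw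
  -- `j = 0` first gives `deg v ≤ g`; this makes `j = g - 1` admissible, which gives `deg v ≤ 1`.
  have hv1 : v.natDegree ≤ 1 := by
    by_contra! hv
    have h0 := h.add_natDegree_le hpn hs hu huv (hex 0 (by omega)) (by omega) (by omega)
    have h1 := h.add_natDegree_le hpn hs hu huv (hex (g - 1) (by omega)) (by omega) (by omega)
    omega
  have hv0 : v = 0 := by
    refine eq_zero_of_degree_lt_of_eval_finset_eq_zero {a, b} ?_ ?_
    · rw [Finset.card_pair hab]
      exact degree_le_natDegree.trans_lt (by exact_mod_cast (by omega))
    · intro c hc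
      rcases Finset.mem_insert.1 hc with rfl | hc
      · rw [hve c ha, hua, zero_div]
      · rw [Finset.mem_singleton] at hc
        rw [hc, hve b hb, hub, zero_div]
  refine eq_zero_of_dvd_of_natDegree_lt (p := f) ⟨w, ?_⟩ (by omega)
  rw [huv, hv0]; ring

end Superspecial

/-! ### Commutative algebra of unramified and Artinian rings -/

/-- A nonzero finitely generated `Ω[R⁄k]` has a simple quotient `R ⧸ m`, and the projection onto it
is a nonzero derivation. -/
lemma Algebra.FormallyUnramified.of_forall_derivation_quotient_maximal {k R : Type*} [CommRing k]
    [CommRing R] [Algebra k R] [Algebra.EssFiniteType k R]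
    (h : ∀ (m : Ideal R) [m.IsMaximal] (D : Derivation k R (R ⧸ m)), D = 0) :
    Algebra.FormallyUnramified k R := by
  rw [Algebra.formallyUnramified_iff]
  by_contra hns
  rw [not_subsingleton_iff_nontrivial] at hns
  obtain ⟨N, hN⟩ := IsCoatomic.exists_coatom (Submodule R (Ω[R⁄k]))
  have := isSimpleModule_iff_isCoatom.2 hN
  obtain ⟨m, hm, ⟨e⟩⟩ := isSimpleModule_iff_quot_maximal.1 this
  let ℓ : Ω[R⁄k] →ₗ[R] R ⧸ m := e.toLinearMap ∘ₗ N.mkQ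
  have h0 : ℓ = 0 := by
    apply Derivation.liftKaehlerDifferential_unique
    rw [h m (ℓ.compDer _), h m (LinearMap.compDer 0 _)]
  have hsurj : Function.Surjective ℓ := e.surjective.comp N.mkQ_surjective
  obtain ⟨x, hx⟩ := hsurj 1
  rw [h0, LinearMap.zero_apply] at hx
  exact zero_ne_one hx

lemma IsArtinianRing.isRegularLocalRing_localization_atPrime {R : Type*} [CommRing R]
    [IsArtinianRing R] [IsReduced R] (q : Ideal R) [q.IsPrime] :
    IsRegularLocalRing (Localization.AtPrime q) := by
  have hF : IsField (Localization.AtPrime q) :=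
    IsArtinianRing.isField_of_isReduced_of_isLocalRing _
  have := hF.isDomain
  have : IsPrincipalIdealRing (Localization.AtPrime q) := by
    let _ := hF.toField
    infer_instance
  infer_instance

/-! ### Derivations applied coefficientwise -/

/-- Apply an additive map to each coefficient of a polynomial. -/
noncomputable def Polynomial.mapCoeffs {A B : Type*} [Semiring A] [Semiring B] (d : A →+ B)
    (P : A[X]) : B[X] :=
  ∑ i ∈ P.support, monomial i (d (P.coeff i))

section MapCoeffs

variable {A B : Type*} [CommRing A] [CommRing B] {d : A →+ B} {φ : A →+* B}

lemma Polynomial.coeff_mapCoeffs (P : A[X]) (k : ℕ) :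
    (mapCoeffs d P).coeff k = d (P.coeff k) := by
  simp only [mapCoeffs, finsetSum_coeff, coeff_monomial, Finset.sum_ite_eq']
  split_ifs with h
  · rfl
  · rw [notMem_support_iff.1 h, map_zero]

lemma Polynomial.mapCoeffs_mul (hd : ∀ a b, d (a * b) = φ a * d b + d a * φ b) (P Q : A[X]) :
    mapCoeffs d (P * Q) = P.map φ * mapCoeffs d Q + mapCoeffs d P * Q.map φ := by
  ext k
  simp only [coeff_mapCoeffs, coeff_mul, coeff_add, coeff_map, map_sum, hd,
    Finset.sum_add_distrib]

lemma map_one_eq_zero_of_leibniz (hd : ∀ a b, d (a * b) = φ a * d b + d a * φ b) : d 1 = 0 := by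
  simpa using hd 1 1

lemma Polynomial.mapCoeffs_pow_succ (hd : ∀ a b, d (a * b) = φ a * d b + d a * φ b) (P : A[X])
    (n : ℕ) :
    mapCoeffs d (P ^ (n + 1)) = ((n + 1 : ℕ) : B[X]) * (P.map φ ^ n * mapCoeffs d P) := by
  induction n with
  | zero => simp
  | succ n ih =>
    rw [pow_succ, mapCoeffs_mul hd, ih, Polynomial.map_pow]
    push_cast
    ring

lemma Polynomial.eval_mapCoeffs_X_sub_C_mul (hd : ∀ a b, d (a * b) = φ a * d b + d a * φ b)
    (c : A) (Q : A[X]) :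
    (mapCoeffs d ((X - C c) * Q)).eval (φ c) = -(d c * (Q.map φ).eval (φ c)) := by
  have h : mapCoeffs d (X - C c) = -C (d c) := by
    ext k
    rw [coeff_mapCoeffs]
    rcases k with _ | _ | k <;> simp [coeff_X, coeff_C, map_one_eq_zero_of_leibniz hd]
  rw [mapCoeffs_mul hd, h]
  simp

lemma Polynomial.natDegree_mapCoeffs_le (P : A[X]) :
    (mapCoeffs d P).natDegree ≤ P.natDegree := by
  rw [natDegree_le_iff_coeff_eq_zero]
  intro m hm
  rw [coeff_mapCoeffs, coeff_eq_zero_of_natDegree_lt hm, map_zero]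

lemma Polynomial.Monic.natDegree_mapCoeffs_le {P : A[X]} (hP : P.Monic) (hd : d 1 = 0) {m : ℕ}
    (hm : P.natDegree = m + 1) : (mapCoeffs d P).natDegree ≤ m := by
  rw [natDegree_le_iff_coeff_eq_zero]
  intro k hk
  rw [coeff_mapCoeffs]
  rcases Nat.lt_or_ge (m + 1) k with h | h
  · rw [coeff_eq_zero_of_natDegree_lt (by omega), map_zero]
  · rw [show k = P.natDegree by omega, hP.coeff_natDegree, hd]

end MapCoeffs

/-! ### From matrix entries to superspecial polynomials and their deformations -/

section CartierManin

variable {K : Type*} [Field K] {p : ℕ} [hp : Fact p.Prime] [CharP K p]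

omit hp in
-- The coefficient of `X ^ t * G` at `i p - 1` is that of `G` at `i p - (t + 1)`: a matrix entry for
-- `i ≤ g`, and beyond the degree of `G` for `i > g`.
lemma X_pow_mul_mem_exactPolys {g : ℕ} {G : K[X]} (hG : G.natDegree < (g + 1) * p - g)
    (h : ∀ i ∈ Finset.Icc 1 g, ∀ j ∈ Finset.Icc 1 g, ∀ k : ℕ, (k : ℤ) = i * p - j → G.coeff k = 0)
    {t : ℕ} (ht : t < g) : X ^ t * G ∈ exactPolys K := by
  rw [mem_exactPolys_iff (p := p)]
  rintro m ⟨i, hi⟩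
  rw [coeff_X_pow_mul']
  split_ifs with htm
  · by_cases hig : i ≤ g
    · have hi0 : 1 ≤ i := by
        rcases i with _ | i
        · simp at hi
        · omega
      refine h i (Finset.mem_Icc.2 ⟨hi0, hig⟩) (t + 1) (Finset.mem_Icc.2 ⟨by omega, by omega⟩) _ ?_
      rw [Nat.cast_sub htm]
      have : (m : ℤ) + 1 = p * i := by exact_mod_cast hi
      push_cast
      linarith
    · have := Nat.mul_le_mul_right p (show g + 1 ≤ i by omega)
      rw [mul_comm i] at this
      exact coeff_eq_zero_of_natDegree_lt (by omega)
  · rfl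

omit hp [CharP K p] in
lemma mul_mem_exactPolys_of_X_pow_mul {g : ℕ} {G : K[X]}
    (h : ∀ t < g, X ^ t * G ∈ exactPolys K) {q : K[X]} (hq : q.degree < g) :
    q * G ∈ exactPolys K := by
  classical
  rw [← mem_degreeLT, degreeLT_eq_span_X_pow] at hq
  induction hq using Submodule.span_induction with
  | mem x hx =>
    simp only [Finset.coe_image, Set.mem_image, Finset.mem_coe, Finset.mem_range] at hx
    obtain ⟨t, ht, rfl⟩ := hx
    exact h t ht
  | zero => simp
  | add x y _ _ hx hy => rw [add_mul]; exact Submodule.add_mem _ hx hy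
  | smul a x _ hx => rw [smul_mul_assoc]; exact Submodule.smul_mem _ a hx

lemma legendrePoly_monic (p g : ℕ) : (legendrePoly p g).Monic := by
  have : (X - 1 : (MvPolynomial (Fin (2 * g - 1)) (ZMod p))[X]).Monic := by
    simpa using monic_X_sub_C (1 : MvPolynomial (Fin (2 * g - 1)) (ZMod p))
  exact (monic_X.mul this).mul (monic_prod_X_sub_C _ _)

omit [CharP K p] in
lemma map_legendrePoly {g : ℕ} (φ : MvPolynomial (Fin (2 * g - 1)) (ZMod p) →+* K) :
    (legendrePoly p g).map φ = (((0 : K) ::ₘ 1 ::ₘ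
      Finset.univ.val.map fun l => φ (MvPolynomial.X l)).map fun a => X - C a).prod := by
  rw [Multiset.map_cons, Multiset.map_cons, Multiset.prod_cons, Multiset.prod_cons,
    Multiset.map_map]
  simp only [legendrePoly, Polynomial.map_mul, Polynomial.map_sub, Polynomial.map_one, map_X,
    map_C, Polynomial.map_prod, C_0, C_1, sub_zero, mul_assoc]
  rfl

/-- A derivation along a point of the locus where the Cartier–Manin matrix vanishes which kills the
entries of the Cartier–Manin matrix kills all variables. -/
theorem derivation_X_eq_zero_of_cartierManinCoeff (hp2 : p ≠ 2) {g : ℕ} (hg : 1 ≤ g)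
    (φ : MvPolynomial (Fin (2 * g - 1)) (ZMod p) →+* K)
    (d : MvPolynomial (Fin (2 * g - 1)) (ZMod p) →+ K)
    (hd : ∀ a b, d (a * b) = φ a * d b + d a * φ b)
    (hφ0 : ∀ i ∈ Finset.Icc 1 g, ∀ j ∈ Finset.Icc 1 g, ∀ k : ℕ, (k : ℤ) = i * p - j →
      φ (cartierManinCoeff p g k) = 0)
    (hd0 : ∀ i ∈ Finset.Icc 1 g, ∀ j ∈ Finset.Icc 1 g, ∀ k : ℕ, (k : ℤ) = i * p - j →
      d (cartierManinCoeff p g k) = 0) (l : Fin (2 * g - 1)) :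
    d (MvPolynomial.X l) = 0 := by
  classical
  obtain ⟨n, hpn⟩ := hp.out.odd_of_ne_two hp2
  have hn2 : (p - 1) / 2 = n := by omega
  have hn : 1 ≤ n := by have := hp.out.two_le; omega
  have hn0 : (n : K) ≠ 0 := by
    rw [Ne, CharP.cast_eq_zero_iff K p]
    intro h
    have := Nat.le_of_dvd (by omega) h
    omega
  have hd1 : d 1 = 0 := map_one_eq_zero_of_leibniz hd
  simp only [cartierManinCoeff, hn2] at hφ0 hd0
  have hPm := legendrePoly_monic p g
  set P := legendrePoly p g with hP
  set S : Multiset K := (0 : K) ::ₘ 1 ::ₘ Finset.univ.val.map fun l => φ (MvPolynomial.X l) with hS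
  have hPS : P.map φ = (S.map fun a => X - C a).prod := map_legendrePoly φ
  have hScard : S.card = 2 * g + 1 := by
    simp only [hS, Multiset.card_cons, Multiset.card_map, Finset.card_val, Finset.card_univ,
      Fintype.card_fin]
    omega
  have hPd : P.natDegree = 2 * g + 1 := by
    rw [← hPm.natDegree_map φ, hPS, natDegree_multiset_prod_X_sub_C_eq_card, hScard]
  have hdeg : (P ^ n).natDegree < (g + 1) * p - g := by
    rw [hPm.natDegree_pow, hPd, hpn]
    have : (g + 1) * (2 * n + 1) = n * (2 * g + 1) + n + g + 1 := by ring
    omega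
  have hSS : IsSuperspecialPoly n g (P.map φ) := fun q hq => by
    refine mul_mem_exactPolys_of_X_pow_mul (fun t ht => ?_) hq
    rw [← Polynomial.map_pow]
    refine X_pow_mul_mem_exactPolys (p := p) (natDegree_map_le.trans_lt hdeg)
      (fun i hi j hj k hk => ?_) ht
    rw [coeff_map]
    exact hφ0 i hi j hj k hk
  have hSnd : S.Nodup := by
    rw [hPS] at hSS
    refine hSS.nodup hpn hScard fun a ha => ?_
    have h0 : (0 : K) ∈ S := by simp [hS]
    have h1 : (1 : K) ∈ S := by simp [hS]
    rw [ha] at h0 h1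
    exact zero_ne_one ((Multiset.eq_of_mem_replicate h0).trans
      (Multiset.eq_of_mem_replicate h1).symm)
  let s : Finset K := ⟨S, hSnd⟩
  have hPs : P.map φ = Lagrange.nodal s id := hPS
  have hex : ∀ j < g, X ^ j * mapCoeffs d P * P.map φ ^ (n - 1) ∈ exactPolys K := by
    intro j hj
    have h1 : X ^ j * mapCoeffs d (P ^ n) ∈ exactPolys K :=
      X_pow_mul_mem_exactPolys (p := p) ((natDegree_mapCoeffs_le _).trans_lt hdeg)
        (fun i hi j hj k hk => by rw [coeff_mapCoeffs]; exact hd0 i hi j hj k hk) hj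
    -- The variation of `f ^ n` is `n u f ^ (n - 1)`, and `n` is invertible in `K`.
    have h2 : X ^ j * mapCoeffs d (P ^ n) =
        (n : K) • (X ^ j * mapCoeffs d P * P.map φ ^ (n - 1)) := by
      conv_lhs => rw [← Nat.sub_add_cancel hn]
      rw [mapCoeffs_pow_succ hd, Nat.sub_add_cancel hn, smul_eq_C_mul, map_natCast]
      ring
    rw [h2] at h1
    exact (Submodule.smul_mem_iff _ hn0).1 h1
  have hP0 : P = (X - C 0) *
      ((X - 1) * ∏ l : Fin (2 * g - 1), (X - C (MvPolynomial.X l))) := by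
    rw [hP, legendrePoly, C_0, sub_zero, mul_assoc]
  have hP1 : P = (X - C 1) * (X * ∏ l : Fin (2 * g - 1), (X - C (MvPolynomial.X l))) := by
    rw [hP, legendrePoly, C_1]; ring
  have hPl : P = (X - C (MvPolynomial.X l)) *
      (X * (X - 1) * ∏ l ∈ Finset.univ.erase l, (X - C (MvPolynomial.X l))) := by
    rw [hP, legendrePoly, ← Finset.mul_prod_erase _ _ (Finset.mem_univ l)]; ring
  have hu0 : (mapCoeffs d P).eval 0 = 0 := by
    have := eval_mapCoeffs_X_sub_C_mul hd 0
      ((X - 1) * ∏ l : Fin (2 * g - 1), (X - C (MvPolynomial.X l)))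
    rwa [← hP0, map_zero, map_zero, zero_mul, neg_zero] at this
  have hu1 : (mapCoeffs d P).eval 1 = 0 := by
    have := eval_mapCoeffs_X_sub_C_mul hd 1
      (X * ∏ l : Fin (2 * g - 1), (X - C (MvPolynomial.X l)))
    rwa [← hP1, map_one, hd1, zero_mul, neg_zero] at this
  have hu : mapCoeffs d P = 0 := by
    rw [hPs] at hSS hex
    refine hSS.eq_zero hpn (s := s) hScard (hPm.natDegree_mapCoeffs_le hd1 hPd) hex
      (a := 0) (b := 1) ?_ ?_ zero_ne_one hu0 hu1
    · change (0 : K) ∈ S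
      simp [hS]
    · change (1 : K) ∈ S
      simp [hS]
  set Q : (MvPolynomial (Fin (2 * g - 1)) (ZMod p))[X] :=
    X * (X - 1) * ∏ l ∈ Finset.univ.erase l, (X - C (MvPolynomial.X l)) with hQ
  have hul := eval_mapCoeffs_X_sub_C_mul hd (MvPolynomial.X l) Q
  rw [← hPl, hu, eval_zero, eq_comm, neg_eq_zero, mul_eq_zero] at hul
  -- The variation at the root `φ z_l` is `-d z_l` times the value there of the cofactor `Q`; that
  -- value is nonzero because the root is simple.
  refine hul.resolve_right fun hroot => ?_
  have hmap : P.map φ = (X - C (φ (MvPolynomial.X l))) * Q.map φ := by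
    conv_lhs => rw [hPl]
    simp
  have hne : P.map φ ≠ 0 := (hPm.map φ).ne_zero
  have hroots : (P.map φ).roots = S := by rw [hPS, roots_multiset_prod_X_sub_C]
  rw [← hroots, hmap, roots_mul (hmap ▸ hne), roots_X_sub_C, Multiset.singleton_add] at hSnd
  refine (Multiset.nodup_cons.1 hSnd).1 ((mem_roots ?_).2 hroot)
  rintro h0
  rw [h0, mul_zero] at hmap
  exact hne hmap

end CartierManin

/-! ### Unramifiedness and the geometric conclusion -/

theorem cartierManin_formallyUnramified (p : ℕ) [Fact p.Prime] (hp : p ≠ 2) (g : ℕ) (hg : 1 ≤ g) :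
    Algebra.FormallyUnramified (ZMod p)
      (MvPolynomial (Fin (2 * g - 1)) (ZMod p) ⧸ cartierManinIdeal p g) := by
  refine .of_forall_derivation_quotient_maximal fun m hm D => ?_
  let A := MvPolynomial (Fin (2 * g - 1)) (ZMod p)
  let I := cartierManinIdeal p g
  let _ : Field ((A ⧸ I) ⧸ m) := Ideal.Quotient.field m
  have : CharP ((A ⧸ I) ⧸ m) p :=
    charP_of_injective_algebraMap (algebraMap (ZMod p) ((A ⧸ I) ⧸ m)).injective p
  let φ : A →+* (A ⧸ I) ⧸ m := (Ideal.Quotient.mk m).comp (Ideal.Quotient.mk I)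
  let d : A →+ (A ⧸ I) ⧸ m :=
    (D : (A ⧸ I) →ₗ[ZMod p] (A ⧸ I) ⧸ m).toAddMonoidHom.comp (Ideal.Quotient.mk I).toAddMonoidHom
  have hd : ∀ a b, d (a * b) = φ a * d b + d a * φ b := fun a b => by
    have h1 : d (a * b) = D (Ideal.Quotient.mk I a * Ideal.Quotient.mk I b) := by
      rw [← map_mul]; rfl
    rw [h1, D.leibniz, mul_comm (d a)]
    rfl
  have hI : ∀ i ∈ Finset.Icc 1 g, ∀ j ∈ Finset.Icc 1 g, ∀ k : ℕ, (k : ℤ) = i * p - j →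
      Ideal.Quotient.mk I (cartierManinCoeff p g k) = 0 := fun i hi j hj k hk =>
    Ideal.Quotient.eq_zero_iff_mem.2 (Ideal.subset_span ⟨i, hi, j, hj, k, hk, rfl⟩)
  have hX := derivation_X_eq_zero_of_cartierManinCoeff hp hg φ d hd
    (fun i hi j hj k hk => by
      change Ideal.Quotient.mk m (Ideal.Quotient.mk I _) = 0
      rw [hI i hi j hj k hk, map_zero])
    (fun i hi j hj k hk => by
      change D (Ideal.Quotient.mk I _) = 0
      rw [hI i hi j hj k hk, map_zero])
  ext x
  obtain ⟨a, rfl⟩ := Ideal.Quotient.mk_surjective x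
  change d a = 0
  induction a using MvPolynomial.induction_on with
  | C c => exact D.map_algebraMap c
  | add a b ha hb => rw [map_add, ha, hb, add_zero]
  | mul_X a l ha => rw [hd, ha, hX l, mul_zero, zero_mul, add_zero]

lemma isRegularLocalRing_structureSheaf_stalk (R : Type*) [CommRing R] (x : PrimeSpectrum R)
    [IsRegularLocalRing (Localization.AtPrime x.asIdeal)] :
    IsRegularLocalRing ((AlgebraicGeometry.Spec.structureSheaf R).presheaf.stalk x) :=
  .of_ringEquiv (IsLocalization.algEquiv x.asIdeal.primeCompl (Localization.AtPrime x.asIdeal)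
    ((AlgebraicGeometry.Spec.structureSheaf R).presheaf.stalk x)).toRingEquiv

theorem theoremC (p : ℕ) [Fact p.Prime] (hp : p ≠ 2) (g : ℕ) (hg : 1 ≤ g) :
    AlgebraicGeometry.IsReduced (cartierManinScheme p g) ∧
      topologicalKrullDim (cartierManinScheme p g) ≤ 0 ∧
      IsNonsingularScheme (cartierManinScheme p g) := by
  let R := MvPolynomial (Fin (2 * g - 1)) (ZMod p) ⧸ cartierManinIdeal p g
  have : Algebra.FormallyUnramified (ZMod p) R := cartierManin_formallyUnramified p hp g hg
  have : IsReduced R := Algebra.FormallyUnramified.isReduced_of_field (ZMod p) R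
  have : Module.Finite (ZMod p) R := Algebra.FormallyUnramified.finite_of_free (ZMod p) R
  have : IsArtinianRing R := IsArtinianRing.of_finite (ZMod p) R
  have hred : AlgebraicGeometry.IsReduced (cartierManinScheme p g) :=
    inferInstanceAs (AlgebraicGeometry.IsReduced (AlgebraicGeometry.Spec (CommRingCat.of R)))
  have (q : Ideal R) [q.IsPrime] : IsRegularLocalRing (Localization.AtPrime q) :=
    IsArtinianRing.isRegularLocalRing_localization_atPrime q
  refine ⟨hred, ?_, ?_⟩
  · change topologicalKrullDim (PrimeSpectrum R) ≤ 0
    rw [PrimeSpectrum.topologicalKrullDim_eq_ringKrullDim]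
    exact Order.KrullDimLE.krullDim_le
  · intro x
    exact isRegularLocalRing_structureSheaf_stalk R x
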